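/- Let $R_1,R_2>0$ and equip $S^2\times S^2$ (unit spheres with Cartesian coordinates $(x_i,y_i,z_i)$, $i=1,2$) with the symplectic form $\omega=R_1\,\omega_{S^2}\oplus R_2\,\omega_{S^2}$, where $\omega_{S^2}$ is the standard area form. For $w\in\mathbb R$ and $\mathbf t=(t_0,t_1,t_2,t_3,t_4)\in\mathbb R^5$ let $$J=R_1z_1+R_2z_2,\qquad H_{w,\mathbf t}=t_0(z_1+z_2)^2+w(t_1z_1+t_2z_2)+t_3(x_1x_2+y_1y_2)+t_4z_1z_2 .$$ The trigonometric Gaudin model is the case $w=0$. Put $m_0=(0,0,1,0,0,-1)$ and, for $w=0$, $t_{4,m_0}^{+}=\dfrac{2t_3\sqrt{R_1R_2}}{R_1+R_2}$. The bifurcation parameter is $t_4$; all other parameters are fixed. In canonical coordinates $(q_1,q_2,p_1,p_2)$ write $S=q_1p_2-q_2p_1$, $M=\frac12(q_1^2+q_2^2)$, $N=\frac12(p_1^2+p_2^2)$. A family $H_t$ goes through a subcritical Hamiltonian Hopf bifurcation at a rank $0$ singularity $m$ of the momentum maps $(J,H_t)$ and at $t=t_*$ if there are $\rho\neq0$, $\sigma\in\{1,-1\}$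 and $a\in\mathbb R$ with $\sigma a<0$ such that: * for $t$ in an open interval around $t_*$, the quadratic part of $H_t$ at $m$ takes the form $(\rho+\nu_1(t))S+\sigma N-\nu_2(t)M$ in linear symplectic coordinates depending smoothly on $t$, where $\nu_1,\nu_2$ are smooth, $\nu_1(t_*)=\nu_2(t_*)=0$ and $\nu_2'(t_*)\neq0$; * in suitable canonical coordinates near $m$, $H_{t_*}-H_{t_*}(m)=\rho S+\sigma N+aM^2+bMS+cS^2+O(|(q,p)|^5)$ for some $b,c\in\mathbb R$. **Corollary 5.2.** In the trigonometric Gaudin model, $m_0$ goes through a subcritical Hamiltonian Hopf bifurcation at $t_4=t_{4,m_0}^{+}$ if $R_1\neq R_2$ and either 1. $2(R_1+R_2)t_0>-\sqrt{R_1R_2}\,t_3$ and $t_3<0$, or 2. $2(R_1+R_2)t_0<-\sqrt{R_1R_2}\,t_3$ and $t_3>0$. -/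

import Mathlib

open scoped ContDiff Topology Matrix

/-- Cartesian coordinates `(x, y, z)` on `ℝ³`. -/
abbrev Space3 : Type := EuclideanSpace ℝ (Fin 3)

/-- The ambient space `ℝ³ × ℝ³`, with coordinates `(x₁, y₁, z₁, x₂, y₂, z₂)`. -/
abbrev SpinSpace : Type := Space3 × Space3

/-- The phase space `S² × S²`. -/
def phaseSpace : Set SpinSpace :=
  Metric.sphere (0 : Space3) 1 ×ˢ Metric.sphere (0 : Space3) 1

/-- The standard area form of the unit sphere `S² ⊆ ℝ³` at the point `u`, evaluated on the tangent
vectors `v` and `w`: the triple product `⟨u, v × w⟩`. -/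
def sphereAreaForm (u v w : Space3) : ℝ :=
  u.ofLp ⬝ᵥ (v.ofLp ⨯₃ w.ofLp)

/-- The symplectic form `R₁ ω_{S²} ⊕ R₂ ω_{S²}` on `S² × S²` at the point `z`. -/
def spinForm (R₁ R₂ : ℝ) (z v w : SpinSpace) : ℝ :=
  R₁ * sphereAreaForm z.1 v.1 w.1 + R₂ * sphereAreaForm z.2 v.2 w.2

/-- The symplectic vector space `ℝ⁴` with coordinates `(q, p) = ((q₁, q₂), (p₁, p₂))`. -/
abbrev CanonicalSpace : Type := (Fin 2 → ℝ) × (Fin 2 → ℝ)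

/-- The standard symplectic form `dq₁ ∧ dp₁ + dq₂ ∧ dp₂`. -/
def standardForm (v w : CanonicalSpace) : ℝ :=
  (v.1 0 * w.2 0 - v.2 0 * w.1 0) + (v.1 1 * w.2 1 - v.2 1 * w.1 1)

/-- `Ψ : U → S² × S²` gives canonical coordinates `(q, p)` near the point `z`: it is smooth on the
open neighbourhood `U` of `0`, sends `0` to `z`, and pulls the symplectic form back to the standard
one. (As the standard form is nondegenerate, `Ψ` is then a local diffeomorphism onto a neighbourhood
of `z` in the four-dimensional manifold `S² × S²`.) -/
structure IsCanonicalParam (R₁ R₂ : ℝ) (z : SpinSpace) (U : Set CanonicalSpace)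
    (Ψ : CanonicalSpace → SpinSpace) : Prop where
  isOpen : IsOpen U
  zero_mem : (0 : CanonicalSpace) ∈ U
  smooth : ContDiffOn ℝ ∞ Ψ U
  mapsTo : Set.MapsTo Ψ U phaseSpace
  map_zero : Ψ 0 = z
  symplectic : ∀ x ∈ U, ∀ v w : CanonicalSpace,
    spinForm R₁ R₂ (Ψ x) (fderiv ℝ Ψ x v) (fderiv ℝ Ψ x w) = standardForm v w

/-- The Hilbert generator `S = q₁ p₂ - q₂ p₁`. -/
def hilbertS (x : CanonicalSpace) : ℝ := x.1 0 * x.2 1 - x.1 1 * x.2 0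

/-- The Hilbert generator `M = (q₁² + q₂²) / 2`. -/
noncomputable def hilbertM (x : CanonicalSpace) : ℝ := (x.1 0 ^ 2 + x.1 1 ^ 2) / 2

/-- The Hilbert generator `N = (p₁² + p₂²) / 2`. -/
noncomputable def hilbertN (x : CanonicalSpace) : ℝ := (x.2 0 ^ 2 + x.2 1 ^ 2) / 2

/-- `z` is a rank `0` singularity of the momentum map `F`: in canonical coordinates near `z` the
Jacobian of `F` at `z` is zero. -/
def IsRankZeroSingularity (R₁ R₂ : ℝ) (F : SpinSpace → ℝ × ℝ) (z : SpinSpace) : Prop :=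
  z ∈ phaseSpace ∧ ∀ U Ψ, IsCanonicalParam R₁ R₂ z U Ψ →
    HasFDerivAt (fun x => F (Ψ x)) (0 : CanonicalSpace →L[ℝ] ℝ × ℝ) 0

/-- The quadratic parts `H_t²` of the Taylor expansions of `H_t` at the point `z` have, for `t` in
an open interval around `t₀`, the unfolding
`(ρ + ν₁(t)) S + σ N - ν₂(t) M`, with `ν₁, ν₂` smooth, `ν₁(t₀) = ν₂(t₀) = 0` and `ν₂'(t₀) ≠ 0`,
with respect to linear symplectic coordinates (given by `P t`) that depend smoothly on `t`. For
`ρ ≠ 0` and `σ = ±1` this says that `H_t` goes through a linear Hamiltonian Hopf bifurcation.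
(The other usual form `(ρ + ν₁) S + σ M - ν₂ N` is obtained from this one by the symplectic change
of coordinates `(q, p) ↦ (p, -q)`, which fixes `S` and exchanges `M` and `N`.) -/
def HasLinearHopfUnfolding (R₁ R₂ : ℝ) (H : ℝ → SpinSpace → ℝ) (z : SpinSpace) (t₀ ρ σ : ℝ) :
    Prop :=
  ∃ U Ψ, IsCanonicalParam R₁ R₂ z U Ψ ∧
    ∃ a b : ℝ, t₀ ∈ Set.Ioo a b ∧
    ∃ (ν₁ ν₂ : ℝ → ℝ) (P : ℝ → CanonicalSpace →L[ℝ] CanonicalSpace),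
      ContDiffOn ℝ ∞ ν₁ (Set.Ioo a b) ∧ ContDiffOn ℝ ∞ ν₂ (Set.Ioo a b) ∧
      ContDiffOn ℝ ∞ P (Set.Ioo a b) ∧
      ν₁ t₀ = 0 ∧ ν₂ t₀ = 0 ∧ deriv ν₂ t₀ ≠ 0 ∧
      ∀ t ∈ Set.Ioo a b,
        (∀ v w : CanonicalSpace, standardForm (P t v) (P t w) = standardForm v w) ∧
        Asymptotics.IsBigO (𝓝 0)
          (fun x : CanonicalSpace => H t (Ψ (P t x)) - H t z -
            ((ρ + ν₁ t) * hilbertS x + σ * hilbertN x - ν₂ t * hilbertM x))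
          (fun x : CanonicalSpace => ‖x‖ ^ 3)

/-- In suitable canonical coordinates near `z`, the function `H` is, up to its constant term, in the
normal form `ρ S + σ N + a M² + b M S + c S² + higher order terms`, where the higher order terms
have order at least five in `(q, p)`. -/
def HasHopfNormalForm (R₁ R₂ : ℝ) (H : SpinSpace → ℝ) (z : SpinSpace) (ρ σ a : ℝ) : Prop :=
  ∃ U Ψ, IsCanonicalParam R₁ R₂ z U Ψ ∧
    ∃ b c : ℝ,
      Asymptotics.IsBigO (𝓝 0)
        (fun x : CanonicalSpace => H (Ψ x) - H z -
          (ρ * hilbertS x + σ * hilbertN x +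
            a * hilbertM x ^ 2 + b * (hilbertM x * hilbertS x) + c * hilbertS x ^ 2))
        (fun x : CanonicalSpace => ‖x‖ ^ 5)

/-- The rank `0` singularity `z` of the system with momentum maps `F_t = (J, H_t)` on
`(S² × S², R₁ ω_{S²} ⊕ R₂ ω_{S²})` goes through a subcritical Hamiltonian Hopf bifurcation at
`t = t₀`: the quadratic part goes through a linear Hamiltonian Hopf bifurcation, and in the normal
form of `H_{t₀}` the coefficient `a` of `M²` satisfies `σ a < 0`. -/
def UndergoesSubcriticalHopf (R₁ R₂ : ℝ) (F : ℝ → SpinSpace → ℝ × ℝ) (z : SpinSpace) (t₀ : ℝ) :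
    Prop :=
  (∀ t, IsRankZeroSingularity R₁ R₂ (F t) z) ∧
  ∃ ρ σ a : ℝ, ρ ≠ 0 ∧ (σ = 1 ∨ σ = -1) ∧
    HasLinearHopfUnfolding R₁ R₂ (fun t x => (F t x).2) z t₀ ρ σ ∧
    HasHopfNormalForm R₁ R₂ (fun x => (F t₀ x).2) z ρ σ a ∧
    σ * a < 0

/-- The first integral `J = R₁ z₁ + R₂ z₂`. -/
def gaudinJ (R₁ R₂ : ℝ) (m : SpinSpace) : ℝ := R₁ * m.1 2 + R₂ * m.2 2

/-- The Hamiltonian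
`H = t₀ (z₁ + z₂)² + w (t₁ z₁ + t₂ z₂) + t₃ (x₁ x₂ + y₁ y₂) + t₄ z₁ z₂`. -/
def gaudinH (w t₀ t₁ t₂ t₃ t₄ : ℝ) (m : SpinSpace) : ℝ :=
  t₀ * (m.1 2 + m.2 2) ^ 2 + w * (t₁ * m.1 2 + t₂ * m.2 2) +
    t₃ * (m.1 0 * m.2 0 + m.1 1 * m.2 1) + t₄ * (m.1 2 * m.2 2)

/-- The momentum map `(J, H)` of the generalised coupled angular momenta system; the trigonometric
Gaudin model is the case `w = 0`. -/
def gaudinMomentumMap (R₁ R₂ w t₀ t₁ t₂ t₃ t₄ : ℝ) (m : SpinSpace) : ℝ × ℝ :=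
  (gaudinJ R₁ R₂ m, gaudinH w t₀ t₁ t₂ t₃ t₄ m)

/-- The point `m₀ = (0, 0, 1, 0, 0, -1)`. -/
noncomputable def pointM0 : SpinSpace := (!₂[0, 0, 1], !₂[0, 0, -1])

/-- The bifurcation value
`t₄⁺ = (w (t₁ R₂ - t₂ R₁) + 2 t₃ √(R₁ R₂)) / (R₁ + R₂)` at `m₀`. -/
noncomputable def t4PlusM0 (R₁ R₂ w t₁ t₂ t₃ : ℝ) : ℝ :=
  (w * (t₁ * R₂ - t₂ * R₁) + 2 * t₃ * √(R₁ * R₂)) / (R₁ + R₂)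

/-!
Lambert's equal-area charts around the poles give canonical coordinates at `m₀` in which the
quadratic part of `H` is `Q = m M + n N + s S`, where `m` is affine in `t₄` and vanishes exactly at
`t₄⁺`, and the quartic part `f` is a polynomial in `M`, `N` and `S`. Since fourth powers of linear
forms span the quartic forms and the time one map of each fourth power is an explicit cubic
transvection, `Q + f` can be changed symplectically into `Q + f + {Q, G}` modulo order five, for any
quartic form `G`. When `m = 0`, a suitable `G = (x M + y N + z S) D` with `D = q₁ p₁ + q₂ p₂`
removes `M N`, `N²` and `S N` without touching the coefficient of `M²`, and a hyperbolic scaling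
normalises `n` to its sign `σ`. At `t₄⁺` with `w = 0`, the sign of `n` times the coefficient of `M²`
is that of `t₄⁺ (4 t₀ + t₄⁺)`.
-/

open scoped Pointwise in
/-- Polarization: signed sums of `(a ± b ± c ± d) ^ 4` give `192 * a * b * c * d`. -/
theorem pow_four_eq_span_pow_four {K A : Type*} [Field K] [CharZero K] [CommRing A] [Algebra K A]
    (L : Submodule K A) : L ^ 4 = Submodule.span K ((· ^ 4) '' (L : Set A)) := by
  apply le_antisymm
  · rw [Submodule.pow_eq_span_pow_set, Submodule.span_le]
    intro y hy
    rw [pow_succ, pow_succ, pow_two] at hy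
    obtain ⟨_, ⟨_, ⟨a, ha, b, hb, rfl⟩, c, hc, rfl⟩, d, hd, rfl⟩ := hy
    have polarization : a * b * c * d = (192 : K)⁻¹ •
        ((a + b + c + d) ^ 4 + (a + b - c - d) ^ 4 + (a - b + c - d) ^ 4 + (a - b - c + d) ^ 4 -
          (a + b + c - d) ^ 4 - (a + b - c + d) ^ 4 - (a - b + c + d) ^ 4 -
          (a - b - c - d) ^ 4) := by
      rw [eq_inv_smul_iff₀ (by norm_num), ofNat_smul_eq_nsmul, nsmul_eq_mul]
      push_cast
      ring
    have pow_mem {y : A} (hy : y ∈ L) : y ^ 4 ∈ Submodule.span K ((· ^ 4) '' (L : Set A)) :=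
      Submodule.subset_span ⟨y, hy, rfl⟩
    change a * b * c * d ∈ _
    rw [polarization]
    refine Submodule.smul_mem _ _ (sub_mem (sub_mem (sub_mem (sub_mem (add_mem (add_mem (add_mem
      (pow_mem ?_) (pow_mem ?_)) (pow_mem ?_)) (pow_mem ?_)) (pow_mem ?_)) (pow_mem ?_))
      (pow_mem ?_)) (pow_mem ?_))
    all_goals
      repeat' first | assumption | apply add_mem | apply sub_mem
  · rw [Submodule.span_le]
    rintro _ ⟨y, hy, rfl⟩
    exact Submodule.pow_mem_pow L hy 4

theorem isBigO_norm_of_sub_isBigO {E : Type*} [NormedAddCommGroup E] {Φ : E → E} {m : ℕ}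
    (hΦ : (fun x => Φ x - x) =O[𝓝 0] fun x => ‖x‖ ^ (m + 1)) : Φ =O[𝓝 0] fun x => ‖x‖ := by
  have hpow : (fun x : E => ‖x‖ ^ (m + 1)) =O[𝓝 0] fun x => ‖x‖ := by
    simpa only [pow_succ', mul_one, Pi.pow_apply] using
      (Asymptotics.isBigO_refl (fun x : E => ‖x‖) _).mul
        (((continuous_norm.pow m).tendsto (0 : E)).isBigO_one ℝ)
  simpa using (hΦ.trans hpow).add (Asymptotics.isBigO_refl (fun x : E => x) _).norm_right

section HomogeneousForms

variable {E : Type*} [NormedAddCommGroup E] [NormedSpace ℝ E]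

variable (E) in
/-- The homogeneous polynomials of degree `k` on `E`, encoded as the `k`-th power of the space of
continuous linear functionals inside the algebra of functions `E → ℝ`. -/
def homogeneousForms (k : ℕ) : Submodule ℝ (E → ℝ) :=
  LinearMap.range (LinearMap.ltoFun ℝ E ℝ ℝ ∘ₗ ContinuousLinearMap.coeLM ℝ) ^ k

variable {j k m : ℕ} {f g : E → ℝ}

theorem continuousLinearMap_mem_homogeneousForms (ℓ : E →L[ℝ] ℝ) :
    ⇑ℓ ∈ homogeneousForms E 1 := by
  rw [homogeneousForms, pow_one]
  exact ⟨ℓ, rfl⟩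

theorem mul_mem_homogeneousForms (hf : f ∈ homogeneousForms E j)
    (hg : g ∈ homogeneousForms E k) : f * g ∈ homogeneousForms E (j + k) := by
  rw [homogeneousForms, pow_add]
  exact Submodule.mul_mem_mul hf hg

theorem pow_mem_homogeneousForms (hf : f ∈ homogeneousForms E k) (n : ℕ) :
    f ^ n ∈ homogeneousForms E (k * n) := by
  rw [homogeneousForms, pow_mul]
  exact Submodule.pow_mem_pow _ hf n

theorem homogeneousForms_induction {p : ℕ → (E → ℝ) → Prop} (const : ∀ r, p 0 fun _ => r)
    (add : ∀ k f g, p k f → p k g → p k (f + g))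
    (mul : ∀ (ℓ : E →L[ℝ] ℝ) k f, f ∈ homogeneousForms E k → p k f → p (k + 1) (ℓ * f))
    (hf : f ∈ homogeneousForms E k) : p k f := by
  refine Submodule.pow_induction_on_left' (C := fun k f _ => p k f) _ const
    (fun f g k _ _ => add k f g) ?_ hf
  rintro _ ⟨ℓ, rfl⟩ k f hf
  exact mul ℓ k f hf

theorem homogeneousForms_four_induction {p : (E → ℝ) → Prop} (zero : p 0)
    (add : ∀ f ∈ homogeneousForms E 4, ∀ g ∈ homogeneousForms E 4, p f → p g → p (f + g))
    (smul_pow : ∀ (r : ℝ) (ℓ : E →L[ℝ] ℝ), p (r • ⇑ℓ ^ 4)) (hf : f ∈ homogeneousForms E 4) :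
    p f := by
  rw [homogeneousForms, pow_four_eq_span_pow_four] at hf add
  refine Submodule.closure_induction zero (fun f g hf hg => add f hf g hg) ?_ hf
  rintro r _ ⟨_, ⟨ℓ, rfl⟩, rfl⟩
  exact smul_pow r ℓ

theorem contDiff_of_mem_homogeneousForms (hf : f ∈ homogeneousForms E k) : ContDiff ℝ ∞ f :=
  homogeneousForms_induction (p := fun _ f => ContDiff ℝ ∞ f) (fun _ => contDiff_const)
    (fun _ _ _ => ContDiff.add) (fun ℓ _ _ _ => ℓ.contDiff.mul) hf

theorem differentiable_of_mem_homogeneousForms (hf : f ∈ homogeneousForms E k) :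
    Differentiable ℝ f :=
  (contDiff_of_mem_homogeneousForms hf).differentiable (by simp)

theorem isBigO_of_mem_homogeneousForms (hf : f ∈ homogeneousForms E k) :
    f =O[𝓝 0] (fun x => ‖x‖ ^ k) := by
  refine homogeneousForms_induction (p := fun k f => f =O[𝓝 0] fun x => ‖x‖ ^ k)
    (fun r => ?_) (fun _ _ _ => Asymptotics.IsBigO.add) (fun ℓ k f _ hf => ?_) hf
  · simpa only [pow_zero] using Asymptotics.isBigO_const_const r (one_ne_zero (α := ℝ)) (𝓝 (0 : E))
  · simp only [pow_succ']
    exact (ℓ.isBigO_id (𝓝 0)).norm_right.mul hf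

theorem isBigO_comp_sub_of_mem_homogeneousForms (hf : f ∈ homogeneousForms E k) {Φ : E → E}
    (hΦ : (fun x => Φ x - x) =O[𝓝 0] fun x => ‖x‖ ^ (m + 1)) :
    (fun x => f (Φ x) - f x) =O[𝓝 0] fun x => ‖x‖ ^ (k + m) := by
  have hΦid := isBigO_norm_of_sub_isBigO hΦ
  have hΦ₀ : Filter.Tendsto Φ (𝓝 0) (𝓝 0) := hΦid.trans_tendsto tendsto_norm_zero
  refine homogeneousForms_induction
    (p := fun k f => (fun x => f (Φ x) - f x) =O[𝓝 0] fun x => ‖x‖ ^ (k + m))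
    (fun r => ?_) (fun k f g hf hg => ?_) (fun ℓ k f hf hdiff => ?_) hf
  · simpa only [sub_self] using Asymptotics.isBigO_zero _ _
  · exact (hf.add hg).congr_left fun x => by simp only [Pi.add_apply]; ring
  · have hfΦ : (fun x => f (Φ x)) =O[𝓝 0] fun x => ‖x‖ ^ k :=
      ((isBigO_of_mem_homogeneousForms hf).comp_tendsto hΦ₀).trans (hΦid.norm_left.pow k)
    have hfirst : (fun x => ℓ (Φ x - x) * f (Φ x)) =O[𝓝 0] fun x => ‖x‖ ^ (k + 1 + m) :=
      (((ℓ.isBigO_comp _ _).trans hΦ).mul hfΦ).congr_right fun x => by ring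
    have hsecond : (fun x => ℓ x * (f (Φ x) - f x)) =O[𝓝 0] fun x => ‖x‖ ^ (k + 1 + m) :=
      ((ℓ.isBigO_id (𝓝 0)).norm_right.mul hdiff).congr_right fun x => by ring
    refine (hfirst.add hsecond).congr_left fun x => ?_
    simp only [Pi.mul_apply, map_sub]
    ring

theorem exists_expansion_of_mem_homogeneousForms_two {Q : E → ℝ} (hQ : Q ∈ homogeneousForms E 2)
    (v : E) : ∃ ℓ : E →L[ℝ] ℝ, ∀ x (s : ℝ), Q (x + s • v) = Q x + s * ℓ x + s ^ 2 * Q v := by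
  rw [homogeneousForms, pow_two] at hQ
  refine Submodule.mul_induction_on hQ ?_ ?_
  · rintro _ ⟨a, rfl⟩ _ ⟨b, rfl⟩
    refine ⟨a v • b + b v • a, fun x s => ?_⟩
    change a (x + s • v) * b (x + s • v) =
      a x * b x + s * (a v * b x + b v * a x) + s ^ 2 * (a v * b v)
    simp only [map_add, map_smul, smul_eq_mul]
    ring
  · rintro f g ⟨a, ha⟩ ⟨b, hb⟩
    refine ⟨a + b, fun x s => ?_⟩
    simp only [Pi.add_apply, ha, hb, add_apply]
    ring

theorem fderiv_eq_of_expansion {Q : E → ℝ} {x v : E} (hQ : DifferentiableAt ℝ Q x) {b c : ℝ}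
    (h : ∀ s : ℝ, Q (x + s • v) = Q x + s * b + s ^ 2 * c) : fderiv ℝ Q x v = b := by
  rw [← hQ.lineDeriv_eq_fderiv, lineDeriv]
  simp only [h]
  have hderiv : HasDerivAt (fun s : ℝ => Q x + s * b + s ^ 2 * c) (1 * b + 2 * 0 ^ 1 * 1 * c) 0 :=
    (((hasDerivAt_id 0).mul_const b).const_add (Q x)).add (((hasDerivAt_id 0).pow 2).mul_const c)
  rw [hderiv.deriv]
  ring

theorem add_smul_of_mem_homogeneousForms_two {Q : E → ℝ} (hQ : Q ∈ homogeneousForms E 2)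
    (x v : E) (s : ℝ) : Q (x + s • v) = Q x + s * fderiv ℝ Q x v + s ^ 2 * Q v := by
  obtain ⟨ℓ, hℓ⟩ := exists_expansion_of_mem_homogeneousForms_two hQ v
  have hd := differentiable_of_mem_homogeneousForms hQ x
  rw [fderiv_eq_of_expansion hd (hℓ x), hℓ]

theorem fderiv_mem_homogeneousForms_one {Q : E → ℝ} (hQ : Q ∈ homogeneousForms E 2) (v : E) :
    (fun x => fderiv ℝ Q x v) ∈ homogeneousForms E 1 := by
  obtain ⟨ℓ, hℓ⟩ := exists_expansion_of_mem_homogeneousForms_two hQ v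
  have hd := differentiable_of_mem_homogeneousForms hQ
  simpa only [fderiv_eq_of_expansion (hd _) (hℓ _)] using continuousLinearMap_mem_homogeneousForms ℓ

end HomogeneousForms

section SymplecticMaps

/-- The derivative of `Φ : ℝ⁴ → ℝ⁴` is everywhere symplectic, and `Φ` fixes the origin. -/
structure IsSymplecticMap (Φ : CanonicalSpace → CanonicalSpace) : Prop where
  contDiff : ContDiff ℝ ∞ Φ
  map_zero : Φ 0 = 0
  symplectic : ∀ x v w, standardForm (fderiv ℝ Φ x v) (fderiv ℝ Φ x w) = standardForm v w

namespace IsSymplecticMap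

variable {Φ Φ' : CanonicalSpace → CanonicalSpace}

theorem id : IsSymplecticMap fun x => x where
  contDiff := contDiff_id
  map_zero := rfl
  symplectic x v w := by simp

theorem comp (hΦ : IsSymplecticMap Φ) (hΦ' : IsSymplecticMap Φ') :
    IsSymplecticMap fun x => Φ (Φ' x) where
  contDiff := hΦ.contDiff.comp hΦ'.contDiff
  map_zero := by rw [hΦ'.map_zero, hΦ.map_zero]
  symplectic x v w := by
    have hchain := fderiv_comp x (hΦ.contDiff.differentiable (by simp) (Φ' x))
      (hΦ'.contDiff.differentiable (by simp) x)
    rw [show (fun x => Φ (Φ' x)) = Φ ∘ Φ' from rfl, hchain]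
    exact (hΦ.symplectic _ _ _).trans (hΦ'.symplectic x v w)

theorem tendsto_zero (hΦ : IsSymplecticMap Φ) : Filter.Tendsto Φ (𝓝 0) (𝓝 0) := by
  simpa only [hΦ.map_zero] using hΦ.contDiff.continuous.tendsto 0

theorem isBigO_norm (hΦ : IsSymplecticMap Φ) : Φ =O[𝓝 0] fun x => ‖x‖ := by
  have hd : DifferentiableAt ℝ Φ 0 := hΦ.contDiff.differentiable (by simp) 0
  simpa only [hΦ.map_zero, sub_zero] using hd.isBigO_sub.norm_right

theorem isBigO_comp (hΦ : IsSymplecticMap Φ) {f : CanonicalSpace → ℝ} {n : ℕ}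
    (hf : f =O[𝓝 0] fun x => ‖x‖ ^ n) : (fun x => f (Φ x)) =O[𝓝 0] fun x => ‖x‖ ^ n :=
  (hf.comp_tendsto hΦ.tendsto_zero).trans (hΦ.isBigO_norm.norm_left.pow n)

end IsSymplecticMap

theorem IsCanonicalParam.comp {R₁ R₂ : ℝ} {z : SpinSpace} {U : Set CanonicalSpace}
    {Ψ : CanonicalSpace → SpinSpace} (hΨ : IsCanonicalParam R₁ R₂ z U Ψ)
    {Φ : CanonicalSpace → CanonicalSpace} (hΦ : IsSymplecticMap Φ) :
    IsCanonicalParam R₁ R₂ z (Φ ⁻¹' U) (fun x => Ψ (Φ x)) where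
  isOpen := hΨ.isOpen.preimage hΦ.contDiff.continuous
  zero_mem := by simpa only [Set.mem_preimage, hΦ.map_zero] using hΨ.zero_mem
  smooth := hΨ.smooth.comp hΦ.contDiff.contDiffOn fun _ hx => hx
  mapsTo _ hx := hΨ.mapsTo hx
  map_zero := by rw [hΦ.map_zero, hΨ.map_zero]
  symplectic x hx v w := by
    have hd : DifferentiableAt ℝ Ψ (Φ x) :=
      (hΨ.smooth.contDiffAt (hΨ.isOpen.mem_nhds hx)).differentiableAt (by simp)
    have hchain := fderiv_comp x hd (hΦ.contDiff.differentiable (by simp) x)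
    rw [show (fun x => Ψ (Φ x)) = Ψ ∘ Φ from rfl, hchain]
    exact (hΨ.symplectic _ hx _ _).trans (hΦ.symplectic x v w)

/-- `f` and `g` agree up to terms of order `n` at the origin, after a symplectic change of
coordinates in `f`. -/
def SymplecticEquivMod (n : ℕ) (f g : CanonicalSpace → ℝ) : Prop :=
  ∃ Φ, IsSymplecticMap Φ ∧ (fun x => f (Φ x) - g x) =O[𝓝 0] fun x => ‖x‖ ^ n

namespace SymplecticEquivMod

variable {n : ℕ} {f g h : CanonicalSpace → ℝ}

theorem of_isBigO (hfg : (fun x => f x - g x) =O[𝓝 0] fun x => ‖x‖ ^ n) :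
    SymplecticEquivMod n f g :=
  ⟨fun x => x, .id, hfg⟩

theorem refl (n : ℕ) (f : CanonicalSpace → ℝ) : SymplecticEquivMod n f f :=
  of_isBigO <| by simpa only [sub_self] using Asymptotics.isBigO_zero _ _

theorem trans (hfg : SymplecticEquivMod n f g) (hgh : SymplecticEquivMod n g h) :
    SymplecticEquivMod n f h := by
  obtain ⟨Φ, hΦ, hfg⟩ := hfg
  obtain ⟨Φ', hΦ', hgh⟩ := hgh
  refine ⟨_, hΦ.comp hΦ', ((hΦ'.isBigO_comp hfg).add hgh).congr_left fun x => ?_⟩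
  ring

end SymplecticEquivMod

/-- The linear map `(q, p) ↦ (l q, l⁻¹ p)`, symplectic for `l ≠ 0`. -/
noncomputable def hyperbolicScaling (l : ℝ) : CanonicalSpace →L[ℝ] CanonicalSpace :=
  l • (ContinuousLinearMap.inl ℝ (Fin 2 → ℝ) (Fin 2 → ℝ)).comp (ContinuousLinearMap.fst ℝ _ _) +
    l⁻¹ • (ContinuousLinearMap.inr ℝ (Fin 2 → ℝ) (Fin 2 → ℝ)).comp (ContinuousLinearMap.snd ℝ _ _)

theorem hyperbolicScaling_apply (l : ℝ) (x : CanonicalSpace) :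
    hyperbolicScaling l x = (l • x.1, l⁻¹ • x.2) := by
  simp [hyperbolicScaling]

theorem standardForm_hyperbolicScaling {l : ℝ} (hl : l ≠ 0) (v w : CanonicalSpace) :
    standardForm (hyperbolicScaling l v) (hyperbolicScaling l w) = standardForm v w := by
  simp only [hyperbolicScaling_apply, standardForm, Pi.smul_apply, smul_eq_mul]
  field_simp

theorem isSymplecticMap_hyperbolicScaling {l : ℝ} (hl : l ≠ 0) :
    IsSymplecticMap (hyperbolicScaling l) where
  contDiff := (hyperbolicScaling l).contDiff
  map_zero := _root_.map_zero _
  symplectic x v w := by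
    rw [ContinuousLinearMap.fderiv, standardForm_hyperbolicScaling hl]

theorem hilbertM_hyperbolicScaling (l : ℝ) (x : CanonicalSpace) :
    hilbertM (hyperbolicScaling l x) = l ^ 2 * hilbertM x := by
  simp only [hyperbolicScaling_apply, hilbertM, Pi.smul_apply, smul_eq_mul]
  ring

theorem hilbertN_hyperbolicScaling (l : ℝ) (x : CanonicalSpace) :
    hilbertN (hyperbolicScaling l x) = hilbertN x / l ^ 2 := by
  simp only [hyperbolicScaling_apply, hilbertN, Pi.smul_apply, smul_eq_mul]
  ring

theorem hilbertS_hyperbolicScaling {l : ℝ} (hl : l ≠ 0) (x : CanonicalSpace) :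
    hilbertS (hyperbolicScaling l x) = hilbertS x := by
  simp only [hyperbolicScaling_apply, hilbertS, Pi.smul_apply, smul_eq_mul]
  field_simp

end SymplecticMaps

section PoissonBracket

/-- The isomorphism between covectors and vectors induced by the standard symplectic form: the
covector `ℓ` is paired with the vector `v` such that `ℓ = ω(v, ·)`. -/
def symplecticDual : (CanonicalSpace →L[ℝ] ℝ) →ₗ[ℝ] CanonicalSpace where
  toFun ℓ := (fun i => ℓ (0, Pi.single i 1), fun i => -ℓ (Pi.single i 1, 0))
  map_add' ℓ ℓ' := by ext i <;> simp [add_comm]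
  map_smul' r ℓ := by ext i <;> simp

theorem symplecticDual_apply (ℓ : CanonicalSpace →L[ℝ] ℝ) : symplecticDual ℓ =
    (fun i => ℓ (0, Pi.single i 1), fun i => -ℓ (Pi.single i 1, 0)) :=
  rfl

theorem standardForm_symplecticDual (ℓ : CanonicalSpace →L[ℝ] ℝ) (x : CanonicalSpace) :
    standardForm (symplecticDual ℓ) x = ℓ x := by
  have hx : x = x.1 0 • (Pi.single 0 1, 0) + x.1 1 • (Pi.single 1 1, 0) +
      (x.2 0 • (0, Pi.single 0 1) + x.2 1 • (0, Pi.single 1 1)) := by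
    ext i <;> fin_cases i <;> simp
  conv_rhs => rw [hx]
  simp only [standardForm, symplecticDual_apply, map_add, map_smul, smul_eq_mul]
  ring

/-- The nonlinear symplectic transvection `x ↦ x + c ℓ(x)³ v` with `ℓ = ω(v, ·)`; it is the time
one flow of a Hamiltonian proportional to `ℓ⁴`. -/
def cubicTransvection (ℓ : CanonicalSpace →L[ℝ] ℝ) (c : ℝ) (x : CanonicalSpace) :
    CanonicalSpace :=
  x + (c * ℓ x ^ 3) • symplecticDual ℓ

theorem hasFDerivAt_cubicTransvection (ℓ : CanonicalSpace →L[ℝ] ℝ) (c : ℝ) (x : CanonicalSpace) :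
    HasFDerivAt (cubicTransvection ℓ c) (ContinuousLinearMap.id ℝ CanonicalSpace +
      (c • (3 * ℓ x ^ 2) • ℓ).smulRight (symplecticDual ℓ)) x := by
  have hcube : HasFDerivAt (fun x => ℓ x ^ 3) ((3 * ℓ x ^ 2) • ℓ) x := by
    simpa using ℓ.hasFDerivAt.pow 3
  exact (hasFDerivAt_id x).add ((hcube.const_mul c).smul_const _)

theorem standardForm_add_smul_symplecticDual (ℓ : CanonicalSpace →L[ℝ] ℝ) (r : ℝ)
    (v w : CanonicalSpace) :
    standardForm (v + (r * ℓ v) • symplecticDual ℓ) (w + (r * ℓ w) • symplecticDual ℓ) =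
      standardForm v w := by
  simp only [← standardForm_symplecticDual ℓ v, ← standardForm_symplecticDual ℓ w]
  simp only [standardForm, Prod.fst_add, Prod.snd_add, Pi.add_apply, Prod.smul_fst, Prod.smul_snd,
    Pi.smul_apply, smul_eq_mul]
  ring

theorem isSymplecticMap_cubicTransvection (ℓ : CanonicalSpace →L[ℝ] ℝ) (c : ℝ) :
    IsSymplecticMap (cubicTransvection ℓ c) where
  contDiff := by unfold cubicTransvection; fun_prop
  map_zero := by simp [cubicTransvection]
  symplectic x v w := by
    rw [(hasFDerivAt_cubicTransvection ℓ c x).fderiv]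
    simp only [add_apply, ContinuousLinearMap.id_apply, ContinuousLinearMap.smulRight_apply,
      smul_apply, smul_eq_mul, ← mul_assoc]
    exact standardForm_add_smul_symplecticDual ℓ _ v w

theorem isBigO_cubicTransvection_sub (ℓ : CanonicalSpace →L[ℝ] ℝ) (c : ℝ) :
    (fun x => cubicTransvection ℓ c x - x) =O[𝓝 0] fun x => ‖x‖ ^ (2 + 1) := by
  simp only [cubicTransvection, add_sub_cancel_left]
  have hcube := ((ℓ.isBigO_id (𝓝 0)).norm_right.pow 3).const_mul_left c
  simpa using hcube.smul (Asymptotics.isBigO_const_const (symplecticDual ℓ) (one_ne_zero' ℝ) _)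

/-- The Poisson bracket `{f, g} = ∑ i, (∂f/∂qᵢ ∂g/∂pᵢ - ∂f/∂pᵢ ∂g/∂qᵢ)`, that is, the derivative of
`f` along the Hamiltonian vector field of `g`. -/
noncomputable def poissonBracket (f g : CanonicalSpace → ℝ) (x : CanonicalSpace) : ℝ :=
  fderiv ℝ f x (symplecticDual (fderiv ℝ g x))

variable {f g h Q G : CanonicalSpace → ℝ}

theorem poissonBracket_zero_right (f : CanonicalSpace → ℝ) : poissonBracket f 0 = 0 := by
  ext x
  simp [poissonBracket]

theorem poissonBracket_add_right (f : CanonicalSpace → ℝ) (hg : Differentiable ℝ g)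
    (hh : Differentiable ℝ h) :
    poissonBracket f (g + h) = poissonBracket f g + poissonBracket f h := by
  ext x
  simp only [poissonBracket, Pi.add_apply, fderiv_add (hg x) (hh x), map_add]

theorem poissonBracket_mul_right (f : CanonicalSpace → ℝ) (hg : Differentiable ℝ g)
    (hh : Differentiable ℝ h) :
    poissonBracket f (g * h) = g * poissonBracket f h + h * poissonBracket f g := by
  ext x
  simp only [poissonBracket, Pi.add_apply, Pi.mul_apply, fderiv_mul (hg x) (hh x), map_add,
    map_smul, smul_eq_mul]

theorem poissonBracket_smul_pow (f : CanonicalSpace → ℝ) (ℓ : CanonicalSpace →L[ℝ] ℝ) (r : ℝ)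
    (n : ℕ) (x : CanonicalSpace) : poissonBracket f (r • (⇑ℓ) ^ n) x =
      r * (n * ℓ x ^ (n - 1) * fderiv ℝ f x (symplecticDual ℓ)) := by
  have hpow : HasFDerivAt (r • (⇑ℓ) ^ n) (r • (n * ℓ x ^ (n - 1)) • ℓ) x :=
    ((ℓ.hasFDerivAt.pow n).const_smul r).congr_fderiv (by rw [nsmul_eq_mul])
  simp only [poissonBracket, hpow.fderiv, map_smul, smul_eq_mul]

theorem symplecticEquivMod_add_poissonBracket_smul_pow_four
    (hQ : Q ∈ homogeneousForms CanonicalSpace 2) (hf : f ∈ homogeneousForms CanonicalSpace 4)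
    (r : ℝ) (ℓ : CanonicalSpace →L[ℝ] ℝ) :
    SymplecticEquivMod 5 (Q + f) (Q + f + poissonBracket Q (r • (⇑ℓ) ^ 4)) := by
  refine ⟨_, isSymplecticMap_cubicTransvection ℓ (4 * r), ?_⟩
  have hquartic : (fun x => f (cubicTransvection ℓ (4 * r) x) - f x) =O[𝓝 0] fun x => ‖x‖ ^ 6 :=
    isBigO_comp_sub_of_mem_homogeneousForms hf (isBigO_cubicTransvection_sub ℓ (4 * r))
  have hsextic : (fun x => (4 * r) ^ 2 * Q (symplecticDual ℓ) * ℓ x ^ 6) =O[𝓝 0]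
      fun x => ‖x‖ ^ 6 := ((ℓ.isBigO_id (𝓝 0)).norm_right.pow 6).const_mul_left _
  refine ((hquartic.add hsextic).congr_left fun x => ?_).trans
    (Asymptotics.isLittleO_norm_pow_norm_pow (by norm_num)).isBigO
  simp only [Pi.add_apply, poissonBracket_smul_pow, cubicTransvection,
    add_smul_of_mem_homogeneousForms_two hQ]
  push_cast
  ring

theorem poissonBracket_smul_pow_four_mem (hQ : Q ∈ homogeneousForms CanonicalSpace 2) (r : ℝ)
    (ℓ : CanonicalSpace →L[ℝ] ℝ) :
    poissonBracket Q (r • (⇑ℓ) ^ 4) ∈ homogeneousForms CanonicalSpace 4 := by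
  have hmem := Submodule.smul_mem _ (r * 4) <| mul_mem_homogeneousForms
    (pow_mem_homogeneousForms (continuousLinearMap_mem_homogeneousForms ℓ) 3)
    (fderiv_mem_homogeneousForms_one hQ (symplecticDual ℓ))
  convert hmem using 1
  ext x
  simp only [poissonBracket_smul_pow, Pi.smul_apply, Pi.mul_apply, Pi.pow_apply, smul_eq_mul]
  push_cast
  ring

theorem poissonBracket_mem_homogeneousForms_four (hQ : Q ∈ homogeneousForms CanonicalSpace 2)
    (hG : G ∈ homogeneousForms CanonicalSpace 4) :
    poissonBracket Q G ∈ homogeneousForms CanonicalSpace 4 := by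
  refine homogeneousForms_four_induction (p := fun G => poissonBracket Q G ∈ _) ?_
    (fun G₁ hG₁ G₂ hG₂ h₁ h₂ => ?_) (poissonBracket_smul_pow_four_mem hQ) hG
  · rw [poissonBracket_zero_right]
    exact zero_mem _
  · rw [poissonBracket_add_right Q (differentiable_of_mem_homogeneousForms hG₁)
      (differentiable_of_mem_homogeneousForms hG₂)]
    exact add_mem h₁ h₂

/-- Each fourth power of a linear form generates a flow of cubic transvections, and the fourth
powers span the quartic forms. -/
theorem symplecticEquivMod_add_poissonBracket (hQ : Q ∈ homogeneousForms CanonicalSpace 2)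
    (hf : f ∈ homogeneousForms CanonicalSpace 4) (hG : G ∈ homogeneousForms CanonicalSpace 4) :
    SymplecticEquivMod 5 (Q + f) (Q + f + poissonBracket Q G) := by
  refine homogeneousForms_four_induction (p := fun G => ∀ f ∈ homogeneousForms CanonicalSpace 4,
    SymplecticEquivMod 5 (Q + f) (Q + f + poissonBracket Q G)) (fun f _ => ?_)
    (fun G₁ hG₁ G₂ hG₂ h₁ h₂ f hf => ?_)
    (fun r ℓ f hf => symplecticEquivMod_add_poissonBracket_smul_pow_four hQ hf r ℓ) hG f hf
  · rw [poissonBracket_zero_right, add_zero]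
    exact .refl 5 _
  · rw [poissonBracket_add_right Q (differentiable_of_mem_homogeneousForms hG₁)
      (differentiable_of_mem_homogeneousForms hG₂)]
    have hstep := h₂ _ (add_mem hf (poissonBracket_mem_homogeneousForms_four hQ hG₁))
    simp only [← add_assoc] at hstep ⊢
    exact (h₁ f hf).trans hstep

end PoissonBracket

section HopfNormalForm

/-- The dilation generator `q₁ p₁ + q₂ p₂`. Together with `M`, `N` and `S` it spans the quadratic
forms invariant under the rotations generated by `S`. -/
def hilbertD (x : CanonicalSpace) : ℝ := x.1 0 * x.2 0 + x.1 1 * x.2 1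

/-- The quadratic form `m M + n N + s S`. -/
noncomputable def hilbertQuadratic (m n s : ℝ) (x : CanonicalSpace) : ℝ :=
  m * hilbertM x + n * hilbertN x + s * hilbertS x

/-- The quartic form `a M² + b M S + c S² + d M N + e N² + f S N`. -/
noncomputable def hilbertQuartic (a b c d e f : ℝ) (x : CanonicalSpace) : ℝ :=
  a * hilbertM x ^ 2 + b * (hilbertM x * hilbertS x) + c * hilbertS x ^ 2 +
    d * (hilbertM x * hilbertN x) + e * hilbertN x ^ 2 + f * (hilbertS x * hilbertN x)

theorem hilbertD_sq (x : CanonicalSpace) :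
    hilbertD x ^ 2 = 4 * (hilbertM x * hilbertN x) - hilbertS x ^ 2 := by
  simp only [hilbertD, hilbertM, hilbertN, hilbertS]
  ring

theorem mul_mem_homogeneousForms_two {E : Type*} [NormedAddCommGroup E] [NormedSpace ℝ E]
    (ℓ ℓ' : E →L[ℝ] ℝ) : (fun x => ℓ x * ℓ' x) ∈ homogeneousForms E 2 :=
  mul_mem_homogeneousForms (continuousLinearMap_mem_homogeneousForms ℓ)
    (continuousLinearMap_mem_homogeneousForms ℓ')

/-- The coordinate `qᵢ`. -/
def coordQ (i : Fin 2) : CanonicalSpace →L[ℝ] ℝ :=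
  (ContinuousLinearMap.proj i).comp (ContinuousLinearMap.fst ℝ _ _)

/-- The coordinate `pᵢ`. -/
def coordP (i : Fin 2) : CanonicalSpace →L[ℝ] ℝ :=
  (ContinuousLinearMap.proj i).comp (ContinuousLinearMap.snd ℝ _ _)

theorem hilbertD_mem : hilbertD ∈ homogeneousForms CanonicalSpace 2 :=
  add_mem (mul_mem_homogeneousForms_two (coordQ 0) (coordP 0))
    (mul_mem_homogeneousForms_two (coordQ 1) (coordP 1))

theorem hilbertS_mem : hilbertS ∈ homogeneousForms CanonicalSpace 2 :=
  sub_mem (mul_mem_homogeneousForms_two (coordQ 0) (coordP 1))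
    (mul_mem_homogeneousForms_two (coordQ 1) (coordP 0))

theorem hilbertM_mem : hilbertM ∈ homogeneousForms CanonicalSpace 2 := by
  convert Submodule.smul_mem _ (2⁻¹ : ℝ) <| add_mem
    (mul_mem_homogeneousForms_two (coordQ 0) (coordQ 0))
    (mul_mem_homogeneousForms_two (coordQ 1) (coordQ 1)) using 1
  ext x
  change (x.1 0 ^ 2 + x.1 1 ^ 2) / 2 = 2⁻¹ * (x.1 0 * x.1 0 + x.1 1 * x.1 1)
  ring

theorem hilbertN_mem : hilbertN ∈ homogeneousForms CanonicalSpace 2 := by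
  convert Submodule.smul_mem _ (2⁻¹ : ℝ) <| add_mem
    (mul_mem_homogeneousForms_two (coordP 0) (coordP 0))
    (mul_mem_homogeneousForms_two (coordP 1) (coordP 1)) using 1
  ext x
  change (x.2 0 ^ 2 + x.2 1 ^ 2) / 2 = 2⁻¹ * (x.2 0 * x.2 0 + x.2 1 * x.2 1)
  ring

theorem hilbertQuadratic_mem (m n s : ℝ) :
    hilbertQuadratic m n s ∈ homogeneousForms CanonicalSpace 2 :=
  add_mem (add_mem (Submodule.smul_mem _ m hilbertM_mem) (Submodule.smul_mem _ n hilbertN_mem))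
    (Submodule.smul_mem _ s hilbertS_mem)

theorem hilbertQuartic_mem (a b c d e f : ℝ) :
    hilbertQuartic a b c d e f ∈ homogeneousForms CanonicalSpace 4 := by
  have hsmul {g h} (r : ℝ) (hg : g ∈ homogeneousForms CanonicalSpace 2)
      (hh : h ∈ homogeneousForms CanonicalSpace 2) :
      (fun x => r * (g x * h x)) ∈ homogeneousForms CanonicalSpace 4 :=
    Submodule.smul_mem _ r (mul_mem_homogeneousForms hg hh)
  unfold hilbertQuartic
  simp only [pow_two]
  exact add_mem (add_mem (add_mem (add_mem (add_mem (hsmul a hilbertM_mem hilbertM_mem)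
    (hsmul b hilbertM_mem hilbertS_mem)) (hsmul c hilbertS_mem hilbertS_mem))
    (hsmul d hilbertM_mem hilbertN_mem)) (hsmul e hilbertN_mem hilbertN_mem))
    (hsmul f hilbertS_mem hilbertN_mem)

theorem fderiv_hilbertD (x v : CanonicalSpace) : fderiv ℝ hilbertD x v =
    x.1 0 * v.2 0 + x.1 1 * v.2 1 + (v.1 0 * x.2 0 + v.1 1 * x.2 1) :=
  fderiv_eq_of_expansion (c := hilbertD v) (differentiable_of_mem_homogeneousForms hilbertD_mem x)
    fun s => by
      simp only [hilbertD, Prod.fst_add, Prod.snd_add, Pi.add_apply, Prod.smul_fst, Prod.smul_snd,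
        Pi.smul_apply, smul_eq_mul]
      ring

theorem fderiv_hilbertQuadratic (m n s : ℝ) (x v : CanonicalSpace) :
    fderiv ℝ (hilbertQuadratic m n s) x v = m * (x.1 0 * v.1 0 + x.1 1 * v.1 1) +
      n * (x.2 0 * v.2 0 + x.2 1 * v.2 1) +
      s * (x.1 0 * v.2 1 - x.1 1 * v.2 0 + (v.1 0 * x.2 1 - v.1 1 * x.2 0)) :=
  fderiv_eq_of_expansion (c := hilbertQuadratic m n s v)
    (differentiable_of_mem_homogeneousForms (hilbertQuadratic_mem m n s) x) fun r => by
      simp only [hilbertQuadratic, hilbertM, hilbertN, hilbertS, Prod.fst_add, Prod.snd_add,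
        Pi.add_apply, Prod.smul_fst, Prod.smul_snd, Pi.smul_apply, smul_eq_mul]
      ring

theorem symplecticDual_fderiv_hilbertD (x : CanonicalSpace) :
    symplecticDual (fderiv ℝ hilbertD x) = (x.1, -x.2) := by
  ext i <;> fin_cases i <;> simp [symplecticDual_apply, fderiv_hilbertD]

theorem symplecticDual_fderiv_hilbertQuadratic (m n s : ℝ) (x : CanonicalSpace) :
    symplecticDual (fderiv ℝ (hilbertQuadratic m n s) x) =
      (![n * x.2 0 - s * x.1 1, n * x.2 1 + s * x.1 0],
        ![-m * x.1 0 - s * x.2 1, -m * x.1 1 + s * x.2 0]) := by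
  ext i <;> fin_cases i <;> simp [symplecticDual_apply, fderiv_hilbertQuadratic] <;> ring

theorem poissonBracket_hilbertQuadratic_hilbertD (m n s : ℝ) :
    poissonBracket (hilbertQuadratic m n s) hilbertD = hilbertQuadratic (2 * m) (-2 * n) 0 := by
  ext x
  simp only [poissonBracket, symplecticDual_fderiv_hilbertD, fderiv_hilbertQuadratic,
    hilbertQuadratic, hilbertM, hilbertN, Pi.neg_apply]
  ring

theorem poissonBracket_hilbertQuadratic (m n s m' n' s' : ℝ) :
    poissonBracket (hilbertQuadratic m n s) (hilbertQuadratic m' n' s') =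
      (m * n' - n * m') • hilbertD := by
  ext x
  simp only [poissonBracket, symplecticDual_fderiv_hilbertQuadratic, fderiv_hilbertQuadratic,
    hilbertD, Matrix.cons_val_zero, Matrix.cons_val_one, Pi.smul_apply, smul_eq_mul]
  ring

theorem poissonBracket_hilbertQuadratic_mul_hilbertD (n s x y z : ℝ) :
    poissonBracket (hilbertQuadratic 0 n s) (hilbertQuadratic x y z * hilbertD) =
      hilbertQuartic 0 0 (n * x) (-6 * n * x) (-2 * n * y) (-2 * n * z) := by
  rw [poissonBracket_mul_right _
    (differentiable_of_mem_homogeneousForms (hilbertQuadratic_mem x y z))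
    (differentiable_of_mem_homogeneousForms hilbertD_mem),
    poissonBracket_hilbertQuadratic_hilbertD, poissonBracket_hilbertQuadratic]
  ext v
  simp only [Pi.add_apply, Pi.mul_apply, Pi.smul_apply, smul_eq_mul, hilbertQuadratic,
    hilbertQuartic]
  linear_combination (-n * x) * hilbertD_sq v

theorem symplecticEquivMod_hopf {n : ℝ} (hn : n ≠ 0) (s a b c d e f : ℝ) :
    SymplecticEquivMod 5 (hilbertQuadratic 0 n s + hilbertQuartic a b c d e f)
      (hilbertQuadratic 0 n s + hilbertQuartic a b (c + d / 6) 0 0 0) := by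
  have hG := mul_mem_homogeneousForms
    (hilbertQuadratic_mem (d / (6 * n)) (e / (2 * n)) (f / (2 * n))) hilbertD_mem
  convert symplecticEquivMod_add_poissonBracket (hilbertQuadratic_mem 0 n s)
    (hilbertQuartic_mem a b c d e f) hG using 1
  rw [poissonBracket_hilbertQuadratic_mul_hilbertD]
  ext x
  simp only [Pi.add_apply, hilbertQuartic]
  field_simp
  ring

/-- When the coefficient of `N` has the sign `σ`, the scaling `l² = σ n` normalises it to `σ`. -/
theorem hilbertQuadratic_hyperbolicScaling {n σ : ℝ} (hσ : σ = 1 ∨ σ = -1) (hn : 0 < σ * n)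
    (m s : ℝ) (x : CanonicalSpace) : hilbertQuadratic m n s (hyperbolicScaling √(σ * n) x) =
      hilbertQuadratic (σ * n * m) σ s x := by
  have hσ₂ : σ ^ 2 = 1 := by rcases hσ with rfl | rfl <;> norm_num
  have hσn : n / (σ * n) = σ := by
    rw [div_eq_iff hn.ne']
    linear_combination -n * hσ₂
  simp only [hilbertQuadratic, hilbertM_hyperbolicScaling, hilbertN_hyperbolicScaling,
    hilbertS_hyperbolicScaling (Real.sqrt_pos.2 hn).ne', Real.sq_sqrt hn.le]
  linear_combination hilbertN x * hσn

theorem IsCanonicalParam.hasHopfNormalForm {R₁ R₂ : ℝ} {z : SpinSpace} {U : Set CanonicalSpace}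
    {Ψ : CanonicalSpace → SpinSpace} (hΨ : IsCanonicalParam R₁ R₂ z U Ψ) {H : SpinSpace → ℝ}
    {n s σ a b c d e f : ℝ} (hσ : σ = 1 ∨ σ = -1) (hn : 0 < σ * n)
    (hH : (fun x => H (Ψ x) - H z - (hilbertQuadratic 0 n s x + hilbertQuartic a b c d e f x))
      =O[𝓝 0] fun x => ‖x‖ ^ 5) :
    HasHopfNormalForm R₁ R₂ H z s σ (n ^ 2 * a) := by
  have hσ₂ : σ ^ 2 = 1 := by rcases hσ with rfl | rfl <;> norm_num
  have hn₀ : n ≠ 0 := by rintro rfl; simp at hn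
  obtain ⟨Φ, hΦ, hΦO⟩ := (SymplecticEquivMod.of_isBigO hH).trans
    (symplecticEquivMod_hopf hn₀ s a b c d e f)
  have hl := (Real.sqrt_pos.2 hn).ne'
  have hscaling := isSymplecticMap_hyperbolicScaling hl
  refine ⟨_, _, hΨ.comp (hΦ.comp hscaling), σ * n * b, c + d / 6,
    (hscaling.isBigO_comp hΦO).congr_left fun x => ?_⟩
  rw [Pi.add_apply, hilbertQuadratic_hyperbolicScaling hσ hn]
  simp only [hilbertQuadratic, hilbertQuartic, hilbertM_hyperbolicScaling,
    hilbertS_hyperbolicScaling hl, Real.sq_sqrt hn.le]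
  linear_combination (-(a * n ^ 2 * hilbertM x ^ 2)) * hσ₂

theorem IsCanonicalParam.hasLinearHopfUnfolding {R₁ R₂ : ℝ} {z : SpinSpace}
    {U : Set CanonicalSpace} {Ψ : CanonicalSpace → SpinSpace} (hΨ : IsCanonicalParam R₁ R₂ z U Ψ)
    {H : ℝ → SpinSpace → ℝ} {m n s : ℝ → ℝ} (hm : ContDiff ℝ ∞ m) (hn : ContDiff ℝ ∞ n)
    (hs : ContDiff ℝ ∞ s) {t₀ σ : ℝ} (hσ : σ = 1 ∨ σ = -1) (hn₀ : 0 < σ * n t₀) (hm₀ : m t₀ = 0)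
    (hm' : deriv m t₀ ≠ 0)
    (hH : ∀ t, (fun x => H t (Ψ x) - H t z - hilbertQuadratic (m t) (n t) (s t) x)
      =O[𝓝 0] fun x => ‖x‖ ^ 3) :
    HasLinearHopfUnfolding R₁ R₂ H z t₀ (s t₀) σ := by
  have hσn : ContDiff ℝ ∞ fun t => σ * n t := contDiff_const.mul hn
  obtain ⟨a, b, ht₀, hpos⟩ := mem_nhds_iff_exists_Ioo_subset.1
    (hσn.continuous.continuousAt.eventually (lt_mem_nhds hn₀))
  have hsqrt : ContDiffOn ℝ ∞ (fun t => √(σ * n t)) (Set.Ioo a b) :=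
    hσn.contDiffOn.sqrt fun t ht => (hpos ht).ne'
  have hderiv : deriv (fun t => -(σ * n t * m t)) t₀ = -(σ * n t₀ * deriv m t₀) := by
    rw [deriv.fun_neg, deriv_fun_mul (hσn.differentiable (by simp) t₀)
      (hm.differentiable (by simp) t₀), hm₀, mul_zero, zero_add]
  refine ⟨U, Ψ, hΨ, a, b, ht₀, fun t => s t - s t₀, fun t => -(σ * n t * m t),
    fun t => hyperbolicScaling √(σ * n t), by fun_prop, by fun_prop, ?_, sub_self _, by simp [hm₀],
    ?_, fun t ht => ?_⟩
  · exact (hsqrt.smul contDiffOn_const).add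
      ((hsqrt.inv fun t ht => (Real.sqrt_pos.2 (hpos ht)).ne').smul contDiffOn_const)
  · rw [hderiv]
    exact neg_ne_zero.2 (mul_ne_zero hn₀.ne' hm')
  · have hl := (Real.sqrt_pos.2 (hpos ht)).ne'
    refine ⟨standardForm_hyperbolicScaling hl,
      ((isSymplecticMap_hyperbolicScaling hl).isBigO_comp (hH t)).congr_left fun x => ?_⟩
    rw [hilbertQuadratic_hyperbolicScaling hσ (hpos ht), hilbertQuadratic]
    ring

end HopfNormalForm

section RankZero

theorem hasFDerivAt_apply_of_mem_sphere {ι E : Type*} [Fintype ι] [NormedAddCommGroup E]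
    [NormedSpace ℝ E] {g : E → EuclideanSpace ℝ ι} {x : E} (hg : DifferentiableAt ℝ g x)
    (hsphere : ∀ᶠ y in 𝓝 x, g y ∈ Metric.sphere 0 1) {i : ι} (hi : |g x i| = 1) :
    HasFDerivAt (fun y => g y i) (0 : E →L[ℝ] ℝ) x := by
  have hbound : ∀ᶠ y in 𝓝 x, |g y i| ≤ 1 := by
    filter_upwards [hsphere] with y hy
    exact (PiLp.norm_apply_le (g y) i).trans (mem_sphere_zero_iff_norm.1 hy).le
  have hextr : IsLocalExtr (fun y => g y i) x := by
    rcases eq_or_eq_neg_of_abs_eq hi with hx | hx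
    · exact .inr (hbound.mono fun y hy => (abs_le.1 hy).2.trans_eq hx.symm)
    · exact .inl (hbound.mono fun y hy => hx.trans_le (abs_le.1 hy).1)
  have hd := ((EuclideanSpace.proj (𝕜 := ℝ) i).differentiableAt.comp x hg).hasFDerivAt
  exact hd.congr_fderiv (hextr.hasFDerivAt_eq_zero hd)

theorem pointM0_mem_phaseSpace : pointM0 ∈ phaseSpace := by
  constructor <;>
  · rw [mem_sphere_zero_iff_norm, EuclideanSpace.norm_eq, Real.sqrt_eq_one]
    simp [pointM0, Fin.sum_univ_three]

theorem isRankZeroSingularity_pointM0 (R₁ R₂ w t₀ t₁ t₂ t₃ t₄ : ℝ) :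
    IsRankZeroSingularity R₁ R₂ (gaudinMomentumMap R₁ R₂ w t₀ t₁ t₂ t₃ t₄) pointM0 := by
  refine ⟨pointM0_mem_phaseSpace, fun U Ψ hΨ => ?_⟩
  have hU := hΨ.isOpen.mem_nhds hΨ.zero_mem
  have hD := (hΨ.smooth.contDiffAt hU).differentiableAt (by simp)
  have hfst (i : Fin 3) := ((EuclideanSpace.proj (𝕜 := ℝ) i).hasFDerivAt.comp 0 hD.hasFDerivAt.fst)
  have hsnd (i : Fin 3) := ((EuclideanSpace.proj (𝕜 := ℝ) i).hasFDerivAt.comp 0 hD.hasFDerivAt.snd)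
  have hz₁ : HasFDerivAt (fun x => (Ψ x).1 2) (0 : CanonicalSpace →L[ℝ] ℝ) 0 :=
    hasFDerivAt_apply_of_mem_sphere hD.fst (by filter_upwards [hU] with y hy using (hΨ.mapsTo hy).1)
      (by simp [hΨ.map_zero, pointM0])
  have hz₂ : HasFDerivAt (fun x => (Ψ x).2 2) (0 : CanonicalSpace →L[ℝ] ℝ) 0 :=
    hasFDerivAt_apply_of_mem_sphere hD.snd (by filter_upwards [hU] with y hy using (hΨ.mapsTo hy).2)
      (by simp [hΨ.map_zero, pointM0])
  have hJ := (hz₁.const_mul R₁).add (hz₂.const_mul R₂)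
  have hH := ((((hz₁.add hz₂).pow 2).const_mul t₀).add
    (((hz₁.const_mul t₁).add (hz₂.const_mul t₂)).const_mul w)).add
    ((((hfst 0).mul (hsnd 0)).add ((hfst 1).mul (hsnd 1))).const_mul t₃) |>.add
    ((hz₁.mul hz₂).const_mul t₄)
  refine (hJ.prodMk hH).congr_fderiv ?_
  ext v <;> simp [hΨ.map_zero, pointM0]

end RankZero

section EqualAreaChart

/-- The ratio `√(1 - |u|² / 4)` of the distance to the axis of the point with equal-area
coordinates `u` to `|u|`. -/
noncomputable def equalAreaFactor (u : ℝ × ℝ) : ℝ := √(1 - (u.1 ^ 2 + u.2 ^ 2) / 4)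

/-- Lambert's equal-area chart of the unit sphere around the pole `(0, 0, ε)`, for `ε = ±1`. -/
noncomputable def equalAreaChart (ε : ℝ) (u : ℝ × ℝ) : Space3 :=
  !₂[u.1 * equalAreaFactor u, u.2 * equalAreaFactor u, ε * (1 - (u.1 ^ 2 + u.2 ^ 2) / 2)]

variable {u : ℝ × ℝ} (ε : ℝ)

theorem equalAreaFactor_sq (hu : u.1 ^ 2 + u.2 ^ 2 < 4) :
    equalAreaFactor u ^ 2 = 1 - (u.1 ^ 2 + u.2 ^ 2) / 4 :=
  Real.sq_sqrt (by linarith)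

theorem contDiffAt_equalAreaFactor (hu : u.1 ^ 2 + u.2 ^ 2 < 4) :
    ContDiffAt ℝ ∞ equalAreaFactor u :=
  ContDiffAt.sqrt (by fun_prop) (by linarith)

theorem isOpen_setOf_sq_add_sq_lt_four : IsOpen {u : ℝ × ℝ | u.1 ^ 2 + u.2 ^ 2 < 4} :=
  isOpen_lt (by fun_prop) continuous_const

theorem hasFDerivAt_sq_add_sq (u : ℝ × ℝ) : HasFDerivAt (fun u : ℝ × ℝ => u.1 ^ 2 + u.2 ^ 2)
    ((2 * u.1) • ContinuousLinearMap.fst ℝ ℝ ℝ + (2 * u.2) • ContinuousLinearMap.snd ℝ ℝ ℝ) u := by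
  simpa using! (hasFDerivAt_fst.pow 2).add (hasFDerivAt_snd (𝕜 := ℝ) (p := u).pow 2)

theorem equalAreaFactor_mul_fderiv (hu : u.1 ^ 2 + u.2 ^ 2 < 4) (v : ℝ × ℝ) :
    equalAreaFactor u * fderiv ℝ equalAreaFactor u v = -(u.1 * v.1 + u.2 * v.2) / 4 := by
  have hleft := (((contDiffAt_equalAreaFactor hu).differentiableAt (by simp)).hasFDerivAt).pow 2
  have hright := ((hasFDerivAt_sq_add_sq u).mul_const (4⁻¹ : ℝ)).const_sub 1
  have heq := hleft.unique <| hright.congr_of_eventuallyEq <| by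
    filter_upwards [isOpen_setOf_sq_add_sq_lt_four.mem_nhds hu] with u' hu'
    rw [equalAreaFactor_sq hu', div_eq_mul_inv]
  have := DFunLike.congr_fun heq v
  simp only [Nat.add_one_sub_one, pow_one, nsmul_eq_mul, Nat.cast_ofNat, smul_apply, smul_eq_mul,
    smul_add, neg_add_rev, add_apply, neg_apply, ContinuousLinearMap.coe_snd',
    ContinuousLinearMap.coe_fst'] at this
  linarith

theorem equalAreaChart_mem_sphere (hε : ε ^ 2 = 1) (hu : u.1 ^ 2 + u.2 ^ 2 < 4) :
    equalAreaChart ε u ∈ Metric.sphere (0 : Space3) 1 := by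
  rw [mem_sphere_zero_iff_norm, EuclideanSpace.norm_eq, Real.sqrt_eq_one]
  simp only [equalAreaChart, Real.norm_eq_abs, sq_abs, Fin.sum_univ_three, PiLp.toLp_apply,
    Matrix.cons_val_zero, Matrix.cons_val_one, Matrix.cons_val]
  linear_combination (u.1 ^ 2 + u.2 ^ 2) * equalAreaFactor_sq hu +
    (1 - (u.1 ^ 2 + u.2 ^ 2) / 2) ^ 2 * hε

theorem contDiffAt_equalAreaChart (hu : u.1 ^ 2 + u.2 ^ 2 < 4) :
    ContDiffAt ℝ ∞ (equalAreaChart ε) u := by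
  rw [contDiffAt_euclidean]
  intro i
  fin_cases i
  · exact contDiffAt_fst.mul (contDiffAt_equalAreaFactor hu)
  · exact contDiffAt_snd.mul (contDiffAt_equalAreaFactor hu)
  · change ContDiffAt ℝ ∞ (fun u : ℝ × ℝ => ε * (1 - (u.1 ^ 2 + u.2 ^ 2) / 2)) u
    fun_prop

theorem fderiv_equalAreaChart (hu : u.1 ^ 2 + u.2 ^ 2 < 4) (v : ℝ × ℝ) :
    fderiv ℝ (equalAreaChart ε) u v =
      !₂[v.1 * equalAreaFactor u + u.1 * fderiv ℝ equalAreaFactor u v,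
        v.2 * equalAreaFactor u + u.2 * fderiv ℝ equalAreaFactor u v,
        -ε * (u.1 * v.1 + u.2 * v.2)] := by
  have hchart := ((contDiffAt_equalAreaChart ε hu).differentiableAt (by simp)).hasFDerivAt
  have hfactor := ((contDiffAt_equalAreaFactor hu).differentiableAt (by simp)).hasFDerivAt
  have happly (i : Fin 3) {D : ℝ × ℝ →L[ℝ] ℝ}
      (hD : HasFDerivAt (fun u => equalAreaChart ε u i) D u) :
      fderiv ℝ (equalAreaChart ε) u v i = D v :=
    DFunLike.congr_fun (((EuclideanSpace.proj (𝕜 := ℝ) i).hasFDerivAt.comp u hchart).unique hD) v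
  ext i
  fin_cases i
  · refine (happly 0 (hasFDerivAt_fst.mul hfactor)).trans ?_
    simp only [add_apply, smul_apply, smul_eq_mul, ContinuousLinearMap.coe_fst', Fin.zero_eta,
      Matrix.cons_val_zero]
    ring
  · refine (happly 1 (hasFDerivAt_snd.mul hfactor)).trans ?_
    simp only [add_apply, smul_apply, smul_eq_mul, ContinuousLinearMap.coe_snd', Fin.mk_one,
      Matrix.cons_val_one, Matrix.cons_val_zero]
    ring
  · refine (happly 2 ((((hasFDerivAt_sq_add_sq u).mul_const 2⁻¹).const_sub 1).const_mul ε)).trans ?_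
    simp only [add_apply, neg_apply, smul_apply, smul_eq_mul, ContinuousLinearMap.coe_fst',
      ContinuousLinearMap.coe_snd', Fin.reduceFinMk, Matrix.cons_val]
    ring

theorem sphereAreaForm_equalAreaChart (hu : u.1 ^ 2 + u.2 ^ 2 < 4) (v w : ℝ × ℝ) :
    sphereAreaForm (equalAreaChart ε u) (fderiv ℝ (equalAreaChart ε) u v)
      (fderiv ℝ (equalAreaChart ε) u w) = ε * (v.1 * w.2 - v.2 * w.1) := by
  rw [fderiv_equalAreaChart ε hu, fderiv_equalAreaChart ε hu]
  simp only [sphereAreaForm, equalAreaChart, cross_apply, Matrix.vec3_dotProduct,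
    Matrix.cons_val_zero, Matrix.cons_val_one, Matrix.cons_val]
  linear_combination ε * (1 + (u.1 ^ 2 + u.2 ^ 2) / 2) * (v.1 * w.2 - v.2 * w.1) *
      equalAreaFactor_sq hu +
    ε * (1 - (u.1 ^ 2 + u.2 ^ 2) / 2) * ((u.1 * w.2 - u.2 * w.1) * equalAreaFactor_mul_fderiv hu v -
      (u.1 * v.2 - u.2 * v.1) * equalAreaFactor_mul_fderiv hu w)

end EqualAreaChart

section PolarChart

/-- The linear map `x ↦ a (Q - i c P)` in the complex notation `Q = q₁ + i q₂`, `P = p₁ + i p₂`.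
The maps for `c = 1` and `c = -1` split `ℝ⁴` into symplectically orthogonal planes, of opposite
orientation, on which `S` generates rotations. -/
noncomputable def complexCombination (a c : ℝ) : CanonicalSpace →L[ℝ] ℝ × ℝ :=
  (a • (coordQ 0 + c • coordP 1)).prod (a • (coordQ 1 - c • coordP 0))

theorem complexCombination_apply (a c : ℝ) (x : CanonicalSpace) :
    complexCombination a c x = (a * (x.1 0 + c * x.2 1), a * (x.1 1 - c * x.2 0)) :=
  rfl

/-- Canonical coordinates around `m₀` built from equal-area charts around the two poles. -/
noncomputable def polarChart (a₁ a₂ : ℝ) (x : CanonicalSpace) : SpinSpace :=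
  (equalAreaChart 1 (complexCombination a₁ (-1) x), equalAreaChart (-1) (complexCombination a₂ 1 x))

/-- The domain of `polarChart`: on each sphere only the opposite pole is left out. -/
def polarDomain (a₁ a₂ : ℝ) : Set CanonicalSpace :=
  complexCombination a₁ (-1) ⁻¹' {u | u.1 ^ 2 + u.2 ^ 2 < 4} ∩
    complexCombination a₂ 1 ⁻¹' {u | u.1 ^ 2 + u.2 ^ 2 < 4}

theorem fderiv_polarChart {a₁ a₂ : ℝ} {x : CanonicalSpace} (hx : x ∈ polarDomain a₁ a₂)
    (v : CanonicalSpace) : fderiv ℝ (polarChart a₁ a₂) x v =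
    (fderiv ℝ (equalAreaChart 1) (complexCombination a₁ (-1) x) (complexCombination a₁ (-1) v),
      fderiv ℝ (equalAreaChart (-1)) (complexCombination a₂ 1 x) (complexCombination a₂ 1 v)) := by
  have hnorth := ((contDiffAt_equalAreaChart 1 hx.1).differentiableAt
    (by simp)).hasFDerivAt.comp x (complexCombination a₁ (-1)).hasFDerivAt
  have hsouth := ((contDiffAt_equalAreaChart (-1) hx.2).differentiableAt
    (by simp)).hasFDerivAt.comp x (complexCombination a₂ 1).hasFDerivAt
  exact DFunLike.congr_fun (hnorth.prodMk hsouth).fderiv v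

theorem isCanonicalParam_polarChart {R₁ R₂ a₁ a₂ : ℝ} (h₁ : 2 * R₁ * a₁ ^ 2 = 1)
    (h₂ : 2 * R₂ * a₂ ^ 2 = 1) :
    IsCanonicalParam R₁ R₂ pointM0 (polarDomain a₁ a₂) (polarChart a₁ a₂) where
  isOpen := (isOpen_setOf_sq_add_sq_lt_four.preimage (complexCombination a₁ (-1)).continuous).inter
    (isOpen_setOf_sq_add_sq_lt_four.preimage (complexCombination a₂ 1).continuous)
  zero_mem := by simp [polarDomain]
  smooth x hx := ContDiffAt.contDiffWithinAt <|
    ((contDiffAt_equalAreaChart 1 hx.1).comp x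
      (complexCombination a₁ (-1)).contDiff.contDiffAt).prodMk
    ((contDiffAt_equalAreaChart (-1) hx.2).comp x
      (complexCombination a₂ 1).contDiff.contDiffAt)
  mapsTo x hx := ⟨equalAreaChart_mem_sphere 1 (by norm_num) hx.1,
    equalAreaChart_mem_sphere (-1) (by norm_num) hx.2⟩
  map_zero := by simp [polarChart, equalAreaChart, pointM0]
  symplectic x hx v w := by
    simp only [spinForm, fderiv_polarChart hx, polarChart, sphereAreaForm_equalAreaChart 1 hx.1,
      sphereAreaForm_equalAreaChart (-1) hx.2]
    simp only [complexCombination_apply, standardForm]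
    linear_combination (1 / 2 * ((v.1 0 - v.2 1) * (w.1 1 + w.2 0)
      - (v.1 1 + v.2 0) * (w.1 0 - w.2 1))) * h₁ -
      (1 / 2 * ((v.1 0 + v.2 1) * (w.1 1 - w.2 0) - (v.1 1 - v.2 0) * (w.1 0 + w.2 1))) * h₂

theorem isBigO_sqrt_one_sub :
    (fun u : ℝ => √(1 - u) - (1 - u / 2)) =O[𝓝 0] fun u => u ^ 2 := by
  refine Asymptotics.IsBigO.of_bound 1 ?_
  filter_upwards [gt_mem_nhds (zero_lt_one' ℝ)] with u hu
  have hs : √(1 - u) ^ 2 = 1 - u := Real.sq_sqrt (by linarith)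
  have hs₀ := Real.sqrt_nonneg (1 - u)
  have hremainder : √(1 - u) - (1 - u / 2) = -((1 - √(1 - u)) ^ 2 / 2) := by
    linear_combination hs / 2
  have hsq : u ^ 2 = (1 - √(1 - u)) ^ 2 * (1 + √(1 - u)) ^ 2 := by
    linear_combination (u + 1 - √(1 - u) ^ 2) * hs
  rw [hremainder, hsq, one_mul, norm_neg, Real.norm_of_nonneg (by positivity),
    Real.norm_of_nonneg (by positivity), div_eq_mul_inv]
  gcongr
  nlinarith

theorem isBigO_sqrt_mul_sqrt {E : Type*} [NormedAddCommGroup E] {A B : E → ℝ}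
    (hA : A =O[𝓝 0] fun x => ‖x‖ ^ 2) (hB : B =O[𝓝 0] fun x => ‖x‖ ^ 2) :
    (fun x => √(1 - A x / 2) * √(1 - B x / 2) - (1 - (A x + B x) / 4))
      =O[𝓝 0] fun x => ‖x‖ ^ 4 := by
  have htendsto {C : E → ℝ} (hC : C =O[𝓝 0] fun x => ‖x‖ ^ 2) : Filter.Tendsto C (𝓝 0) (𝓝 0) :=
    hC.trans_tendsto (by simpa using! (continuous_norm.pow 2).tendsto (0 : E))
  have hAB : (fun x => A x * B x) =O[𝓝 0] fun x => ‖x‖ ^ 4 :=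
    (hA.mul hB).congr_right fun x => by ring
  have hu : (fun x => (A x + B x) / 2 - A x * B x / 4) =O[𝓝 0] fun x => ‖x‖ ^ 2 :=
    (((hA.add hB).const_mul_left 2⁻¹).sub ((hAB.trans
      (Asymptotics.isLittleO_norm_pow_norm_pow (by norm_num)).isBigO).const_mul_left
      4⁻¹)).congr_left fun x => by ring
  have hsqrt := (isBigO_sqrt_one_sub.comp_tendsto (htendsto hu)).trans (hu.pow 2)
  refine ((hsqrt.congr_right fun x => ?_).sub (hAB.const_mul_left (-8⁻¹))).congr' ?_ .rfl
  · ring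
  filter_upwards [(htendsto hA).eventually (gt_mem_nhds two_pos)] with x hx
  have hfactor : 1 - ((A x + B x) / 2 - A x * B x / 4) = (1 - A x / 2) * (1 - B x / 2) := by ring
  rw [Function.comp_apply, hfactor, Real.sqrt_mul (by linarith)]
  ring

/-- Half of `|u|²` for the equal-area coordinates `u` on the first sphere. -/
noncomputable def northAction (a₁ : ℝ) : CanonicalSpace → ℝ :=
  hilbertQuadratic (a₁ ^ 2) (a₁ ^ 2) (-a₁ ^ 2)

/-- Half of `|u|²` for the equal-area coordinates `u` on the second sphere. -/
noncomputable def southAction (a₂ : ℝ) : CanonicalSpace → ℝ :=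
  hilbertQuadratic (a₂ ^ 2) (a₂ ^ 2) (a₂ ^ 2)

theorem complexCombination_neg_one_sq_add_sq (a₁ : ℝ) (x : CanonicalSpace) :
    (complexCombination a₁ (-1) x).1 ^ 2 + (complexCombination a₁ (-1) x).2 ^ 2 =
      2 * northAction a₁ x := by
  simp only [complexCombination_apply, northAction, hilbertQuadratic, hilbertM, hilbertN, hilbertS]
  ring

theorem complexCombination_one_sq_add_sq (a₂ : ℝ) (x : CanonicalSpace) :
    (complexCombination a₂ 1 x).1 ^ 2 + (complexCombination a₂ 1 x).2 ^ 2 =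
      2 * southAction a₂ x := by
  simp only [complexCombination_apply, southAction, hilbertQuadratic, hilbertM, hilbertN, hilbertS]
  ring

theorem complexCombination_dotProduct (a₁ a₂ : ℝ) (x : CanonicalSpace) :
    (complexCombination a₁ (-1) x).1 * (complexCombination a₂ 1 x).1 +
      (complexCombination a₁ (-1) x).2 * (complexCombination a₂ 1 x).2 =
      2 * a₁ * a₂ * (hilbertM x - hilbertN x) := by
  simp only [complexCombination_apply, hilbertM, hilbertN]
  ring

theorem gaudinH_polarChart (a₁ a₂ w t₀ t₁ t₂ t₃ t₄ : ℝ) (x : CanonicalSpace) :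
    gaudinH w t₀ t₁ t₂ t₃ t₄ (polarChart a₁ a₂ x) - gaudinH w t₀ t₁ t₂ t₃ t₄ pointM0 =
      t₀ * (southAction a₂ x - northAction a₁ x) ^ 2 +
      w * (t₂ * southAction a₂ x - t₁ * northAction a₁ x) +
      2 * a₁ * a₂ * t₃ * (hilbertM x - hilbertN x) *
        (√(1 - northAction a₁ x / 2) * √(1 - southAction a₂ x / 2)) +
      t₄ * (northAction a₁ x + southAction a₂ x - northAction a₁ x * southAction a₂ x) := by
  have hnorth : 1 - 2 * northAction a₁ x / 4 = 1 - northAction a₁ x / 2 := by ring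
  have hsouth : 1 - 2 * southAction a₂ x / 4 = 1 - southAction a₂ x / 2 := by ring
  simp only [gaudinH, polarChart, equalAreaChart, equalAreaFactor, pointM0,
    complexCombination_neg_one_sq_add_sq, complexCombination_one_sq_add_sq, hnorth, hsouth,
    Matrix.cons_val_zero, Matrix.cons_val_one, Matrix.cons_val]
  linear_combination t₃ * √(1 - northAction a₁ x / 2) * √(1 - southAction a₂ x / 2) *
    complexCombination_dotProduct a₁ a₂ x

/-- The coefficient of `M` in the Gaudin Hamiltonian at `m₀` in `polarChart`. -/
noncomputable def gaudinCoeffM (a₁ a₂ w t₁ t₂ t₃ t₄ : ℝ) : ℝ :=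
  2 * a₁ * a₂ * t₃ + w * (t₂ * a₂ ^ 2 - t₁ * a₁ ^ 2) + t₄ * (a₁ ^ 2 + a₂ ^ 2)

/-- The coefficient of `N` in the Gaudin Hamiltonian at `m₀` in `polarChart`. -/
noncomputable def gaudinCoeffN (a₁ a₂ w t₁ t₂ t₃ t₄ : ℝ) : ℝ :=
  -(2 * a₁ * a₂ * t₃) + w * (t₂ * a₂ ^ 2 - t₁ * a₁ ^ 2) + t₄ * (a₁ ^ 2 + a₂ ^ 2)

/-- The coefficient of `S` in the Gaudin Hamiltonian at `m₀` in `polarChart`. -/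
noncomputable def gaudinCoeffS (a₁ a₂ w t₁ t₂ t₄ : ℝ) : ℝ :=
  w * (t₂ * a₂ ^ 2 + t₁ * a₁ ^ 2) + t₄ * (a₂ ^ 2 - a₁ ^ 2)

/-- The coefficient of `M ^ 2` in the Gaudin Hamiltonian at `m₀` in `polarChart`. -/
noncomputable def gaudinCoeffMSq (a₁ a₂ t₀ t₃ t₄ : ℝ) : ℝ :=
  t₀ * (a₂ ^ 2 - a₁ ^ 2) ^ 2 - a₁ * a₂ * t₃ * (a₁ ^ 2 + a₂ ^ 2) / 2 - t₄ * a₁ ^ 2 * a₂ ^ 2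

/-- The quadratic part of the Gaudin Hamiltonian at `m₀` in `polarChart`. -/
noncomputable def gaudinQuadratic (a₁ a₂ w t₁ t₂ t₃ t₄ : ℝ) : CanonicalSpace → ℝ :=
  hilbertQuadratic (gaudinCoeffM a₁ a₂ w t₁ t₂ t₃ t₄) (gaudinCoeffN a₁ a₂ w t₁ t₂ t₃ t₄)
    (gaudinCoeffS a₁ a₂ w t₁ t₂ t₄)

/-- The quartic part of the Gaudin Hamiltonian at `m₀` in `polarChart`. -/
noncomputable def gaudinQuartic (a₁ a₂ t₀ t₃ t₄ : ℝ) : CanonicalSpace → ℝ :=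
  hilbertQuartic (gaudinCoeffMSq a₁ a₂ t₀ t₃ t₄)
    ((a₂ ^ 2 - a₁ ^ 2) * (2 * t₀ * (a₁ ^ 2 + a₂ ^ 2) - a₁ * a₂ * t₃ / 2))
    (t₀ * (a₁ ^ 2 + a₂ ^ 2) ^ 2 + t₄ * a₁ ^ 2 * a₂ ^ 2)
    (2 * t₀ * (a₂ ^ 2 - a₁ ^ 2) ^ 2 - 2 * t₄ * a₁ ^ 2 * a₂ ^ 2)
    (t₀ * (a₂ ^ 2 - a₁ ^ 2) ^ 2 + a₁ * a₂ * t₃ * (a₁ ^ 2 + a₂ ^ 2) / 2 - t₄ * a₁ ^ 2 * a₂ ^ 2)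
    ((a₂ ^ 2 - a₁ ^ 2) * (2 * t₀ * (a₁ ^ 2 + a₂ ^ 2) + a₁ * a₂ * t₃ / 2))

theorem isBigO_gaudinH_polarChart (a₁ a₂ w t₀ t₁ t₂ t₃ t₄ : ℝ) :
    (fun x => gaudinH w t₀ t₁ t₂ t₃ t₄ (polarChart a₁ a₂ x) - gaudinH w t₀ t₁ t₂ t₃ t₄ pointM0 -
      (gaudinQuadratic a₁ a₂ w t₁ t₂ t₃ t₄ x + gaudinQuartic a₁ a₂ t₀ t₃ t₄ x))
      =O[𝓝 0] fun x => ‖x‖ ^ 5 := by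
  have hnorth := isBigO_of_mem_homogeneousForms (hilbertQuadratic_mem (a₁ ^ 2) (a₁ ^ 2) (-a₁ ^ 2))
  have hsouth := isBigO_of_mem_homogeneousForms (hilbertQuadratic_mem (a₂ ^ 2) (a₂ ^ 2) (a₂ ^ 2))
  have hMN : (fun x => 2 * a₁ * a₂ * t₃ * (hilbertM x - hilbertN x)) =O[𝓝 0] fun x => ‖x‖ ^ 2 :=
    (isBigO_of_mem_homogeneousForms (sub_mem hilbertM_mem hilbertN_mem)).const_mul_left _
  have hremainder := (hMN.mul (isBigO_sqrt_mul_sqrt hnorth hsouth)).congr_right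
    (g₂ := fun x => ‖x‖ ^ 6) fun x => by ring
  refine (hremainder.trans
    (Asymptotics.isLittleO_norm_pow_norm_pow (by norm_num)).isBigO).congr_left fun x => ?_
  rw [gaudinH_polarChart]
  simp only [gaudinQuadratic, gaudinQuartic, gaudinCoeffM, gaudinCoeffN, gaudinCoeffS,
    gaudinCoeffMSq, northAction, southAction, hilbertQuadratic, hilbertQuartic]
  ring

theorem isBigO_gaudinH_polarChart_sub_gaudinQuadratic (a₁ a₂ w t₀ t₁ t₂ t₃ t₄ : ℝ) :
    (fun x => gaudinH w t₀ t₁ t₂ t₃ t₄ (polarChart a₁ a₂ x) - gaudinH w t₀ t₁ t₂ t₃ t₄ pointM0 -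
      gaudinQuadratic a₁ a₂ w t₁ t₂ t₃ t₄ x) =O[𝓝 0] fun x => ‖x‖ ^ 3 := by
  have hfour := (isBigO_gaudinH_polarChart a₁ a₂ w t₀ t₁ t₂ t₃ t₄).trans
    (Asymptotics.isLittleO_norm_pow_norm_pow (show 4 < 5 by norm_num)).isBigO
  have hquartic : gaudinQuartic a₁ a₂ t₀ t₃ t₄ =O[𝓝 0] fun x => ‖x‖ ^ 4 :=
    isBigO_of_mem_homogeneousForms (hilbertQuartic_mem _ _ _ _ _ _)
  refine ((hfour.add hquartic).trans
    (Asymptotics.isLittleO_norm_pow_norm_pow (by norm_num)).isBigO).congr_left fun x => ?_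
  ring

end PolarChart

section Bifurcation

theorem undergoesSubcriticalHopf_pointM0 {R₁ R₂ a₁ a₂ : ℝ} (h₁ : 2 * R₁ * a₁ ^ 2 = 1)
    (h₂ : 2 * R₂ * a₂ ^ 2 = 1) {w t₀ t₁ t₂ t₃ t₄ : ℝ}
    (hM : gaudinCoeffM a₁ a₂ w t₁ t₂ t₃ t₄ = 0) (hS : gaudinCoeffS a₁ a₂ w t₁ t₂ t₄ ≠ 0)
    (hneg : gaudinCoeffN a₁ a₂ w t₁ t₂ t₃ t₄ * gaudinCoeffMSq a₁ a₂ t₀ t₃ t₄ < 0) :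
    UndergoesSubcriticalHopf R₁ R₂ (fun t => gaudinMomentumMap R₁ R₂ w t₀ t₁ t₂ t₃ t)
      pointM0 t₄ := by
  obtain ⟨σ, hσ, hσN⟩ : ∃ σ : ℝ, (σ = 1 ∨ σ = -1) ∧ 0 < σ * gaudinCoeffN a₁ a₂ w t₁ t₂ t₃ t₄ := by
    rcases (left_ne_zero_of_mul hneg.ne).lt_or_gt with hN | hN
    · exact ⟨-1, .inr rfl, by linarith⟩
    · exact ⟨1, .inl rfl, by linarith⟩
  have hslope : deriv (gaudinCoeffM a₁ a₂ w t₁ t₂ t₃) t₄ ≠ 0 := by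
    have ha₁ : a₁ ≠ 0 := by rintro rfl; simp at h₁
    have : deriv (gaudinCoeffM a₁ a₂ w t₁ t₂ t₃) t₄ = a₁ ^ 2 + a₂ ^ 2 := by
      unfold gaudinCoeffM
      simp
    rw [this]
    positivity
  have hΨ := isCanonicalParam_polarChart h₁ h₂
  have hexpansion := isBigO_gaudinH_polarChart a₁ a₂ w t₀ t₁ t₂ t₃ t₄
  rw [gaudinQuadratic, hM] at hexpansion
  refine ⟨isRankZeroSingularity_pointM0 R₁ R₂ w t₀ t₁ t₂ t₃, _, σ, _, hS, hσ,
    hΨ.hasLinearHopfUnfolding ?_ ?_ ?_ hσ hσN hM hslope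
      (isBigO_gaudinH_polarChart_sub_gaudinQuadratic a₁ a₂ w t₀ t₁ t₂ t₃),
    hΨ.hasHopfNormalForm hσ hσN hexpansion, ?_⟩
  · unfold gaudinCoeffM
    fun_prop
  · unfold gaudinCoeffN
    fun_prop
  · unfold gaudinCoeffS
    fun_prop
  · linarith [mul_neg_of_pos_of_neg hσN hneg]

/-- The opposite signs of `a₁` and `a₂` make the coefficient of `M`, rather than that of `N`, vanish
at the bifurcation value `t₄⁺`. -/
theorem exists_polarChart_scales {R₁ R₂ : ℝ} (hR₁ : 0 < R₁) (hR₂ : 0 < R₂) :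
    ∃ a₁ a₂ : ℝ, 2 * R₁ * a₁ ^ 2 = 1 ∧ 2 * R₂ * a₂ ^ 2 = 1 ∧ 2 * √(R₁ * R₂) * (a₁ * a₂) = -1 := by
  refine ⟨(√(2 * R₁))⁻¹, -(√(2 * R₂))⁻¹, ?_, ?_, ?_⟩
  · rw [inv_pow, Real.sq_sqrt (by positivity), mul_inv_cancel₀ (by positivity)]
  · rw [neg_sq, inv_pow, Real.sq_sqrt (by positivity), mul_inv_cancel₀ (by positivity)]
  · have hsqrt : √(2 * R₁) * √(2 * R₂) = 2 * √(R₁ * R₂) := by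
      rw [← Real.sqrt_mul (by positivity), show 2 * R₁ * (2 * R₂) = 2 ^ 2 * (R₁ * R₂) by ring,
        Real.sqrt_mul (by positivity), Real.sqrt_sq (by positivity)]
    rw [mul_neg, ← mul_inv, hsqrt, mul_neg, mul_inv_cancel₀ (by positivity)]

theorem gaudinCoeffM_t4PlusM0 {R₁ R₂ a₁ a₂ : ℝ} (hR₁ : 0 < R₁) (hR₂ : 0 < R₂)
    (h₁ : 2 * R₁ * a₁ ^ 2 = 1) (h₂ : 2 * R₂ * a₂ ^ 2 = 1)
    (h₁₂ : 2 * √(R₁ * R₂) * (a₁ * a₂) = -1) (w t₁ t₂ t₃ : ℝ) :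
    gaudinCoeffM a₁ a₂ w t₁ t₂ t₃ (t4PlusM0 R₁ R₂ w t₁ t₂ t₃) = 0 := by
  have ha₁ : a₁ ^ 2 = 1 / (2 * R₁) := by field_simp; linarith
  have ha₂ : a₂ ^ 2 = 1 / (2 * R₂) := by field_simp; linarith
  have ha₁₂ : a₁ * a₂ = -1 / (2 * √(R₁ * R₂)) := by field_simp; linarith
  have hsq : √(R₁ * R₂) ^ 2 = R₁ * R₂ := Real.sq_sqrt (by positivity)
  rw [gaudinCoeffM, t4PlusM0, mul_assoc 2, ha₁, ha₂, ha₁₂]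
  field_simp
  linear_combination 2 * t₃ * (R₁ + R₂) * hsq

theorem gaudinCoeffN_mul_gaudinCoeffMSq {a₁ a₂ t₁ t₂ t₃ t₄ : ℝ}
    (hM : gaudinCoeffM a₁ a₂ 0 t₁ t₂ t₃ t₄ = 0) (t₀ : ℝ) :
    gaudinCoeffN a₁ a₂ 0 t₁ t₂ t₃ t₄ * gaudinCoeffMSq a₁ a₂ t₀ t₃ t₄ =
      t₄ * (4 * t₀ + t₄) * ((a₁ ^ 2 + a₂ ^ 2) * (a₂ ^ 2 - a₁ ^ 2) ^ 2 / 2) := by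
  have hN : gaudinCoeffN a₁ a₂ 0 t₁ t₂ t₃ t₄ = 2 * t₄ * (a₁ ^ 2 + a₂ ^ 2) := by
    rw [gaudinCoeffM] at hM
    rw [gaudinCoeffN]
    linear_combination -hM
  have hMSq : gaudinCoeffMSq a₁ a₂ t₀ t₃ t₄ = (t₀ + t₄ / 4) * (a₂ ^ 2 - a₁ ^ 2) ^ 2 := by
    rw [gaudinCoeffM] at hM
    rw [gaudinCoeffMSq]
    linear_combination -(a₁ ^ 2 + a₂ ^ 2) / 4 * hM
  rw [hN, hMSq]
  ring

theorem undergoesSubcriticalHopf_trigonometricGaudin {R₁ R₂ : ℝ} (hR₁ : 0 < R₁) (hR₂ : 0 < R₂)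
    (hR : R₁ ≠ R₂) {t₀ t₁ t₂ t₃ : ℝ}
    (hneg : t4PlusM0 R₁ R₂ 0 t₁ t₂ t₃ * (4 * t₀ + t4PlusM0 R₁ R₂ 0 t₁ t₂ t₃) < 0) :
    UndergoesSubcriticalHopf R₁ R₂ (fun t => gaudinMomentumMap R₁ R₂ 0 t₀ t₁ t₂ t₃ t)
      pointM0 (t4PlusM0 R₁ R₂ 0 t₁ t₂ t₃) := by
  obtain ⟨a₁, a₂, h₁, h₂, h₁₂⟩ := exists_polarChart_scales hR₁ hR₂
  have hM := gaudinCoeffM_t4PlusM0 hR₁ hR₂ h₁ h₂ h₁₂ 0 t₁ t₂ t₃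
  have hdiff : a₂ ^ 2 - a₁ ^ 2 ≠ 0 := fun h => hR <| by
    linear_combination 2 * R₁ * R₂ * h + R₂ * h₁ - R₁ * h₂
  have ha₁ : a₁ ≠ 0 := by rintro rfl; simp at h₁
  refine undergoesSubcriticalHopf_pointM0 h₁ h₂ hM ?_ ?_
  · simpa [gaudinCoeffS, hdiff] using left_ne_zero_of_mul hneg.ne
  · rw [gaudinCoeffN_mul_gaudinCoeffMSq hM]
    exact mul_neg_of_neg_of_pos hneg (by positivity)

end Bifurcation

theorem corollary5p2 (R₁ R₂ : ℝ) (hR₁ : 0 < R₁) (hR₂ : 0 < R₂) (hR : R₁ ≠ R₂)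
    (t₀ t₁ t₂ t₃ : ℝ)
    (h : (2 * (R₁ + R₂) * t₀ > -(√(R₁ * R₂) * t₃) ∧ t₃ < 0) ∨
         (2 * (R₁ + R₂) * t₀ < -(√(R₁ * R₂) * t₃) ∧ t₃ > 0)) :
    UndergoesSubcriticalHopf R₁ R₂
      (fun t₄ => gaudinMomentumMap R₁ R₂ 0 t₀ t₁ t₂ t₃ t₄)
      pointM0 (t4PlusM0 R₁ R₂ 0 t₁ t₂ t₃) := by
  apply undergoesSubcriticalHopf_trigonometricGaudin hR₁ hR₂ hR
  have hprod : t₃ * (2 * (R₁ + R₂) * t₀ + √(R₁ * R₂) * t₃) < 0 := by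
    rcases h with ⟨h, ht₃⟩ | ⟨h, ht₃⟩
    · exact mul_neg_of_neg_of_pos ht₃ (by linarith)
    · exact mul_neg_of_pos_of_neg ht₃ (by linarith)
  have hvalue : t4PlusM0 R₁ R₂ 0 t₁ t₂ t₃ * (4 * t₀ + t4PlusM0 R₁ R₂ 0 t₁ t₂ t₃) =
      4 * √(R₁ * R₂) / (R₁ + R₂) ^ 2 * (t₃ * (2 * (R₁ + R₂) * t₀ + √(R₁ * R₂) * t₃)) := by
    rw [t4PlusM0]
    field_simp
    ring
  rw [hvalue]
  exact mul_neg_of_pos_of_neg (by positivity) hprod
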